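/- Let $(N,E)$ be a finite connected graph whose edges are given an arbitrary orientation, $E\subseteq N\times N$ (so $(i,j)\in E$ implies $(j,i)\notin E$). Let $M_j>0$, $p^L_j\in\mathbb R$, $\underline d_j\le 0\le\overline d_j$ and $\underline\omega_j<0<\overline\omega_j$ for $j\in N$, let $B_{ij}>0$ for $(i,j)\in E$, and let $f_j:\mathbb R^{n_j}\times\mathbb R\to\mathbb R^{n_j}$ and $g_j:\mathbb R^{n_j}\times\mathbb R\to\mathbb R$ be globally Lipschitz for $j\in N$. For states $x=(\eta,\omega,x^s)$ with $\eta\in\mathbb R^{E}$, $\omega\in\mathbb R^{N}$, $x^s_j\in\mathbb R^{n_j}$, consider the swing-equation network with on-off loads $$\dot\eta_{ij}=\omega_i-\omega_j,\quad (i,j)\in E,$$ $$M_j\dot\omega_j=-p^L_j+g_j(x^s_j,-\omega_j)-d^c_j-\sum_{k:(j,k)\in E}B_{jk}\sin\eta_{jk}+\sum_{i:(i,j)\in E}B_{ij}\sin\eta_{ij},\qquad \dot x^s_j=f_j(x^s_j,-\omega_j),\quad j\in N,$$ where $d^c_j=f^c_j(\omega_j)$ equals $\overline d_j$ if $\omega_j>\overline\omega_j$,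 $0$ if $\underline\omega_j<\omega_j\le\overline\omega_j$, and $\underline d_j$ if $\omega_j\le\underline\omega_j$. Let $\dot x\in Q(x)$ be the differential inclusion obtained by replacing $d^c_j$ by an arbitrary $v_j\in F_j(\omega_j)$ (chosen independently for each $j$), where $F_j(\overline\omega_j)=[0,\overline d_j]$, $F_j(\underline\omega_j)=[\underline d_j,0]$, and $F_j(\omega_j)=\{f^c_j(\omega_j)\}$ otherwise. A Filippov solution on $[0,\infty)$ is a map $x$ that is absolutely continuous on every $[0,T]$ and satisfies $\dot x(t)\in Q(x(t))$ for almost every $t\ge 0$. An equilibrium is a point $x^*$ with $0\in Q(x^*)$. Assume: 1. For every $j\in N$ there is $\bar x$ with $f_j(\bar x,0)=0$, and for every constant $\bar\omega\in\mathbb R$ each compact set that is invariant (in forward and backward time) under $\dot x=f_j(x,-\bar\omega)$ consists of equilibrium points only. 2. There is $j\in N$ such that $f_j(\bar x,-\bar\omega)=0$ implies $\bar\omega=0$, for all $\bar x\in\mathbb R^{n_j}$ and $\bar\omega\in\mathbb R$. Let $x^*=(\eta^*,\omega^*,x^{s,*})$ be an equilibrium such that $|\eta^*_{ij}|<\pi/2$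 for all $(i,j)\in E$ and such that: 3. For every $j\in N$ there are open neighbourhoods $\Omega_j$ of $-\omega^*_j$ and $X_j$ of $x^{s,*}_j$, a continuously differentiable function $V_j\ge 0$ on $X_j$ with a strict local minimum at $x^{s,*}_j$, and a positive definite function $\phi_j:\mathbb R\to\mathbb R$ (that is, $\phi_j(0)=0$ and $\phi_j(u)>0$ for $u\neq0$) with $$\nabla V_j(x)\cdot f_j(x,u)\le (u+\omega^*_j)\bigl(g_j(x,u)-g_j(x^{s,*}_j,-\omega^*_j)\bigr)-\phi_j(u+\omega^*_j)\qquad\text{for all }u\in\Omega_j,\ x\in X_j.$$ Then $\omega^*=0$, and there is an open neighbourhood $\Xi$ of $x^*$ such that every Filippov solution $x:[0,\infty)\to\mathbb R^{|E|+|N|+\sum_j n_j}$ with $x(0)\in\Xi$ converges to the set of equilibria, i.e. its distance to that set tends to $0$ as $t\to\infty$; in particular $\omega(t)\to\omega^*=0$. -/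

import Mathlib

open Filter Topology MeasureTheory

noncomputable section

/-- The data of the network: a connected graph with bus set `N` and an (arbitrarily) oriented set
of lines `E`, the parameters of the swing equation and of the on-off loads, and the supply
dynamics `x' = f j x u`, `s = g j x u` with input `u = -ω j` at every bus `j`. -/
structure PowerNetwork (N : Type*) where
  /-- The oriented transmission lines. -/
  E : Finset (N × N)
  /-- At most one of the two orientations of a line is used; in particular there are no loops. -/
  orientation : ∀ i j : N, (i, j) ∈ E → (j, i) ∉ E
  /-- The underlying undirected graph is connected. -/
  connected : (SimpleGraph.fromRel fun i j : N => (i, j) ∈ E).Connected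
  /-- Generator inertia. -/
  M : N → ℝ
  M_pos : ∀ j, 0 < M j
  /-- Line susceptances. -/
  B : E → ℝ
  B_pos : ∀ e, 0 < B e
  /-- Frequency-independent load. -/
  pL : N → ℝ
  /-- Off-nominal value of the on-off load at low frequency. -/
  dLow : N → ℝ
  dLow_nonpos : ∀ j, dLow j ≤ 0
  /-- Off-nominal value of the on-off load at high frequency. -/
  dHigh : N → ℝ
  dHigh_nonneg : ∀ j, 0 ≤ dHigh j
  /-- Lower frequency threshold. -/
  ωLow : N → ℝ
  ωLow_neg : ∀ j, ωLow j < 0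
  /-- Upper frequency threshold. -/
  ωHigh : N → ℝ
  ωHigh_pos : ∀ j, 0 < ωHigh j
  /-- Dimension of the state of the supply dynamics. -/
  n : N → ℕ
  /-- Vector field of the supply dynamics. -/
  f : ∀ j, EuclideanSpace ℝ (Fin (n j)) → ℝ → EuclideanSpace ℝ (Fin (n j))
  /-- Output map of the supply dynamics. -/
  g : ∀ j, EuclideanSpace ℝ (Fin (n j)) → ℝ → ℝ
  f_lipschitz : ∀ j, ∃ K, LipschitzWith K fun p : EuclideanSpace ℝ (Fin (n j)) × ℝ => f j p.1 p.2
  g_lipschitz : ∀ j, ∃ K, LipschitzWith K fun p : EuclideanSpace ℝ (Fin (n j)) × ℝ => g j p.1 p.2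

/-- `K` is an invariant set of the autonomous equation `x' = F x`: every solution on `ℝ` that
is in `K` at time `0` is in `K` at all (positive and negative) times. -/
def IsInvariantSet {X : Type*} [NormedAddCommGroup X] [NormedSpace ℝ X] (F : X → X) (K : Set X) :
    Prop :=
  ∀ γ : ℝ → X, (∀ t, HasDerivAt γ (F (γ t)) t) → γ 0 ∈ K → ∀ t, γ t ∈ K

/-- A positive definite function on `ℝ`. -/
def IsPositiveDefinite (φ : ℝ → ℝ) : Prop :=
  φ 0 = 0 ∧ ∀ u, u ≠ 0 → 0 < φ u

/-- `V` is a storage function which witnesses that the system `x' = f x u`, `s = g x u` is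
locally input strictly passive around the constant input `uBar` and the point `xBar`.
The derivative of `V` along the system is `fderiv ℝ V x (f x u)`. -/
def IsLocalStorageFunction {X : Type*} [NormedAddCommGroup X] [NormedSpace ℝ X]
    (f : X → ℝ → X) (g : X → ℝ → ℝ) (uBar : ℝ) (xBar : X) (V : X → ℝ) : Prop :=
  ∃ (Ω : Set ℝ) (U : Set X) (φ : ℝ → ℝ),
    IsOpen Ω ∧ uBar ∈ Ω ∧ IsOpen U ∧ xBar ∈ U ∧ IsPositiveDefinite φ ∧
    ContDiffOn ℝ 1 V U ∧ (∀ x ∈ U, 0 ≤ V x) ∧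
    ∀ u ∈ Ω, ∀ x ∈ U,
      fderiv ℝ V x (f x u) ≤ (u - uBar) * (g x u - g xBar uBar) - φ (u - uBar)

namespace PowerNetwork

variable {N : Type*} (P : PowerNetwork N)

/-- The state space of triples `(η, ω, xˢ)`: `x.1 e` is the power angle difference of the line `e`,
`x.2.1 j` the frequency deviation and `x.2.2 j` the supply state at the bus `j`. -/
abbrev State : Type _ :=
  (P.E → ℝ) × (N → ℝ) × (∀ j, EuclideanSpace ℝ (Fin (P.n j)))

/-- The discontinuous map that describes the on-off load at bus `j`. -/
def onOffLoad (j : N) (ω : ℝ) : ℝ :=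
  if P.ωHigh j < ω then P.dHigh j else if P.ωLow j < ω then 0 else P.dLow j

/-- The Filippov set-valued map of the on-off load at bus `j`. -/
def filippovLoad (j : N) (ω : ℝ) : Set ℝ :=
  if ω = P.ωHigh j then Set.Icc 0 (P.dHigh j)
  else if ω = P.ωLow j then Set.Icc (P.dLow j) 0
  else {P.onOffLoad j ω}

/-- The power transmitted along the line `e`. -/
def lineFlow (η : P.E → ℝ) (e : P.E) : ℝ :=
  P.B e * Real.sin (η e)

/-- The set-valued right-hand side `Q` of the differential inclusion `x' ∈ Q x`. -/
def Q [DecidableEq N] (x : P.State) : Set P.State :=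
  {z | (∀ e : P.E, z.1 e = x.2.1 e.1.1 - x.2.1 e.1.2) ∧
    (∀ j, ∃ v ∈ P.filippovLoad j (x.2.1 j),
      z.2.1 j = 1 / P.M j * (-P.pL j + P.g j (x.2.2 j) (-x.2.1 j) - v
        - (∑ e : P.E with e.1.1 = j, P.lineFlow x.1 e)
        + ∑ e : P.E with e.1.2 = j, P.lineFlow x.1 e)) ∧
    ∀ j, z.2.2 j = P.f j (x.2.2 j) (-x.2.1 j)}

/-- The set of equilibria of the differential inclusion. -/
def equilibria [DecidableEq N] : Set P.State :=
  {x | (0 : P.State) ∈ P.Q x}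

/-- `x`, restricted to `[0, ∞)`, is a Filippov solution: it is absolutely continuous on every
`[0, T]` and satisfies the differential inclusion at almost every time. -/
def IsFilippovSolution [Fintype N] [DecidableEq N] (x : ℝ → P.State) : Prop :=
  (∀ T : ℝ, 0 ≤ T → AbsolutelyContinuousOnInterval x 0 T) ∧
    ∀ᵐ t : ℝ, 0 < t → ∃ z ∈ P.Q (x t), HasDerivAt x z t

/-- At every bus the supply dynamics have an equilibrium for zero input, and for every constant
input their compact invariant sets consist of equilibrium points only. -/
def SupplyRegularity : Prop :=
  ∀ j, (∃ x, P.f j x 0 = 0) ∧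
    ∀ (ωBar : ℝ) (K : Set (EuclideanSpace ℝ (Fin (P.n j)))), IsCompact K →
      IsInvariantSet (fun x => P.f j x (-ωBar)) K → ∀ x ∈ K, P.f j x (-ωBar) = 0

/-- At some bus the supply dynamics can be at rest only at the nominal frequency. -/
def NominalFrequencyBus : Prop :=
  ∃ j, ∀ xBar ωBar, P.f j xBar (-ωBar) = 0 → ωBar = 0

/-- At every bus the supply dynamics are locally input strictly passive around the input and the
state given by `xStar`, with a storage function that has a strict minimum there. -/
def LocallyPassiveAt (xStar : P.State) : Prop :=
  ∀ j, ∃ V : EuclideanSpace ℝ (Fin (P.n j)) → ℝ,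
    IsLocalStorageFunction (P.f j) (P.g j) (-xStar.2.1 j) (xStar.2.2 j) V ∧
      ∀ᶠ x in 𝓝[≠] (xStar.2.2 j), V (xStar.2.2 j) < V x

end PowerNetwork

end

/-! At an equilibrium the frequencies agree along every line, hence at all buses by connectedness,
and one bus forces the common value to be 0. Zero lies strictly between the load thresholds, so near
`xStar` all on-off loads vanish and the inclusion reduces to the continuous equation x' =
`nominalField` x. Filippov solutions that stay there are classical ones.

The Lyapunov function `energy` adds kinetic energy, the Bregman distance of the line potential -B
cos η, and the storage functions. Its derivative loses all line terms (`hasDerivAt_energy`), and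
passivity bounds what remains by -∑ φ j (-ω j). Since `energy` has a strict minimum at `xStar` on a
small ball (`energy_lt_energy`), solutions starting close enough never leave that ball
(`exists_isOpen_forall_mem_closedBall`).

Barbalat's lemma sends the dissipation to 0, which forces ω → 0. Applied again to ω, it sends the
power surplus to 0. Each supply state then solves an equation whose input tends to 0, so by Grönwall
its limit set is invariant under the zero-input equation (`isInvariantSet_setOf_mapClusterPt`);
being compact, it consists of rest points. Hence every cluster point is an equilibrium, and
compactness turns this into convergence of the distance. -/

/-! ### Real analysis and cluster points of trajectories -/

/-- An absolutely continuous function whose derivative agrees almost everywhere with a continuous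
function is differentiable everywhere in the interior of the interval. -/
theorem AbsolutelyContinuousOnInterval.hasDerivAt_of_ae_hasDerivAt {E : Type*}
    [NormedAddCommGroup E] [NormedSpace ℝ E] [CompleteSpace E] {x y : ℝ → E} {T : ℝ}
    (hT : 0 ≤ T) (hx : AbsolutelyContinuousOnInterval x 0 T)
    (hy : ContinuousOn y (Set.Icc 0 T))
    (hxy : ∀ᵐ t : ℝ, t ∈ Set.Ioo 0 T → HasDerivAt x (y t) t) :
    ∀ t ∈ Set.Ioo 0 T, HasDerivAt x (y t) t := by
  -- Constant extension beyond the endpoints makes `y` globally continuous, so its primitive is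
  -- differentiable everywhere; `x` minus this primitive has derivative 0 a.e. and is constant.
  obtain ⟨w, hw, hwy⟩ : ∃ w : ℝ → E, Continuous w ∧ ∀ t ∈ Set.Icc 0 T, w t = y t :=
    ⟨Set.IccExtend hT ((Set.Icc 0 T).domRestrict y), (hy.domRestrict).Icc_extend',
      fun t ht => Set.IccExtend_of_mem hT _ ht⟩
  have hz : ∀ t, HasDerivAt (fun t => ∫ s in (0 : ℝ)..t, w s) (w t) t := fun t =>
    hw.integral_hasStrictDerivAt 0 t |>.hasDerivAt
  have hzac : AbsolutelyContinuousOnInterval (fun t => ∫ s in (0 : ℝ)..t, w s) 0 T := by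
    obtain ⟨C, hC⟩ := (isCompact_uIcc (a := (0 : ℝ)) (b := T)).exists_bound_of_continuousOn
      hw.continuousOn
    refine LipschitzOnWith.absolutelyContinuousOnInterval (K := C.toNNReal) ?_
    refine Convex.lipschitzOnWith_of_nnnorm_hasDerivWithin_le (convex_uIcc 0 T)
      (fun t _ => (hz t).hasDerivWithinAt) fun t ht => ?_
    rw [← NNReal.coe_le_coe, coe_nnnorm]
    exact (hC t ht).trans (Real.le_coe_toNNReal C)
  obtain ⟨c, hc⟩ := (hx.fun_sub hzac).const_of_ae_hasDerivAt_zero (by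
    have h0 : ∀ᵐ t : ℝ, t ≠ 0 := by simp [ae_iff]
    have hTne : ∀ᵐ t : ℝ, t ≠ T := by simp [ae_iff]
    filter_upwards [hxy, h0, hTne] with t ht h0 h1 htT
    rw [Set.uIcc_of_le hT] at htT
    have := (ht ⟨lt_of_le_of_ne htT.1 h0.symm, lt_of_le_of_ne htT.2 h1⟩).sub (hz t)
    simpa [hwy t htT] using! this)
  intro t ht
  rw [Set.uIcc_of_le hT] at hc
  rw [← hwy t (Set.Ioo_subset_Icc_self ht)]
  refine ((hz t).add_const c).congr_of_eventuallyEq ?_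
  filter_upwards [Ioo_mem_nhds ht.1 ht.2] with s hs
  rw [← hc s (Set.Ioo_subset_Icc_self hs)]
  abel

/-- Barbalat's lemma. -/
theorem tendsto_deriv_zero_of_uniformContinuousOn {F G : ℝ → ℝ} {l : ℝ}
    (hF : ∀ t > 0, HasDerivAt F (G t) t) (hG : UniformContinuousOn G (Set.Ioi 0))
    (hl : Tendsto F atTop (𝓝 l)) : Tendsto G atTop (𝓝 0) := by
  rw [Metric.tendsto_atTop]
  intro ε hε
  obtain ⟨δ, hδ, hGδ⟩ := Metric.uniformContinuousOn_iff.1 hG (ε / 2) (by positivity)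
  -- Over a step of length δ/2 the increment of `F` is below 2 · εδ/8, so the mean slope is at most
  -- ε/2.
  obtain ⟨T, hT⟩ := Metric.tendsto_atTop.1 hl (ε * δ / 8) (by positivity)
  refine ⟨max T 1, fun t ht => ?_⟩
  have ht0 : 0 < t := by linarith [le_max_right T 1]
  have htT : T ≤ t := (le_max_left T 1).trans ht
  obtain ⟨s, hs, hGs⟩ := exists_hasDerivAt_eq_slope F G (show t < t + δ / 2 by linarith)
    (fun s hs => (hF s (ht0.trans_le hs.1)).continuousAt.continuousWithinAt)
    (fun s hs => hF s (ht0.trans hs.1))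
  have h1 := hT t htT
  have h2 := hT (t + δ / 2) (by linarith)
  have h3 := hGδ t ht0 s (ht0.trans hs.1) (by
    rw [Real.dist_eq, abs_lt]; constructor <;> linarith [hs.1, hs.2])
  rw [Real.dist_eq, abs_lt] at h1 h2 h3
  have h4 : |G s| ≤ ε / 2 := by
    rw [hGs, add_sub_cancel_left, abs_div, abs_of_pos (half_pos hδ), div_le_iff₀ (half_pos hδ),
      abs_le]
    constructor <;> linarith [h1.1, h1.2, h2.1, h2.2]
  rw [abs_le] at h4
  rw [Real.dist_eq, sub_zero, abs_lt]
  constructor <;> linarith [h4.1, h4.2, h3.1, h3.2]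

/-- A real function which is nonincreasing on `[a, ∞)` and bounded below converges. -/
theorem AntitoneOn.exists_tendsto_atTop {F : ℝ → ℝ} {a m : ℝ} (hF : AntitoneOn F (Set.Ici a))
    (hm : ∀ t ≥ a, m ≤ F t) : ∃ l, Tendsto F atTop (𝓝 l) := by
  have hanti : Antitone fun t => F (max a t) := fun s t hst =>
    hF (le_max_left a s) (le_max_left a t) (max_le_max le_rfl hst)
  refine ⟨_, (tendsto_atTop_ciInf hanti ⟨m, ?_⟩).congr' ?_⟩
  · rintro _ ⟨t, rfl⟩
    exact hm _ (le_max_left a t)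
  · filter_upwards [eventually_ge_atTop a] with t ht
    simp [max_eq_right ht]

/-- A continuous function along a bounded trajectory of a continuous vector field is uniformly
continuous. -/
theorem uniformContinuousOn_comp_of_hasDerivAt {E G : Type*} [NormedAddCommGroup E]
    [NormedSpace ℝ E] [UniformSpace G] {F : E → E} {a : E → G} {x : ℝ → E} {K : Set E}
    (hK : IsCompact K) (hF : ContinuousOn F K) (ha : ContinuousOn a K)
    (hxK : ∀ t > 0, x t ∈ K) (hx : ∀ t > 0, HasDerivAt x (F (x t)) t) :
    UniformContinuousOn (fun t => a (x t)) (Set.Ioi 0) := by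
  obtain ⟨C, hC⟩ := hK.exists_bound_of_continuousOn hF
  have hlip : LipschitzOnWith C.toNNReal x (Set.Ioi 0) := by
    refine Convex.lipschitzOnWith_of_nnnorm_hasDerivWithin_le (convex_Ioi 0)
      (fun t ht => (hx t ht).hasDerivWithinAt) fun t ht => ?_
    rw [← NNReal.coe_le_coe, coe_nnnorm]
    exact (hC _ (hxK t ht)).trans (Real.le_coe_toNNReal C)
  exact (hK.uniformContinuousOn_of_continuous ha).comp hlip.uniformContinuousOn hxK

/-- A trajectory in a compact set eventually enters each open set that contains all its cluster
points. -/
theorem IsCompact.eventually_mem_of_forall_mapClusterPt {X ι : Type*} [TopologicalSpace X]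
    {l : Filter ι} {x : ι → X} {K O : Set X} (hK : IsCompact K) (hxK : ∀ᶠ t in l, x t ∈ K)
    (hO : IsOpen O) (h : ∀ p ∈ K, MapClusterPt p l x → p ∈ O) : ∀ᶠ t in l, x t ∈ O := by
  by_contra hcon
  rw [not_eventually] at hcon
  obtain ⟨p, hp, hpx⟩ := (hK.diff hO).exists_mapClusterPt_of_frequently
    ((hcon.and_eventually hxK).mono fun t ht => ⟨ht.2, ht.1⟩)
  exact hp.2 (h p hp.1 hpx)

/-- Cluster points of a trajectory in a closed set are zeros of the continuous functions which
tend to zero along the trajectory. -/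
theorem MapClusterPt.eq_of_tendsto {X Y ι : Type*} [TopologicalSpace X] [TopologicalSpace Y]
    [T2Space Y] {l : Filter ι} {x : ι → X} {K : Set X} {p : X} {a : X → Y} {y : Y}
    (hp : MapClusterPt p l x) (hpK : p ∈ K) (hxK : ∀ᶠ t in l, x t ∈ K) (ha : ContinuousOn a K)
    (hy : Tendsto (fun t => a (x t)) l (𝓝 y)) : a p = y := by
  obtain ⟨𝒰, h𝒰, hx⟩ := mapClusterPt_iff_ultrafilter.1 hp
  refine tendsto_nhds_unique (f := fun t => a (x t)) ((ha p hpK).tendsto.comp ?_) (hy.mono_left h𝒰)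
  exact tendsto_nhdsWithin_iff.2 ⟨hx, h𝒰 hxK⟩

/-! ### Lyapunov stability and decay of the dissipation -/

/-- Lyapunov stability in a compact ball on which the function is minimal at the center only. -/
theorem exists_isOpen_forall_mem_closedBall {E : Type*} [NormedAddCommGroup E] [NormedSpace ℝ E]
    [ProperSpace E] {p : E} {r : ℝ} (hr : 0 < r) {F : E → E} {U W : E → ℝ}
    (hU : ContinuousOn U (Metric.closedBall p r))
    (hmin : ∀ q ∈ Metric.closedBall p r, q ≠ p → U p < U q)
    (hderiv : ∀ (γ : ℝ → E) (t : ℝ), γ t ∈ Metric.closedBall p r → HasDerivAt γ (F (γ t)) t →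
      HasDerivAt (fun s => U (γ s)) (W (γ t)) t)
    (hW : ∀ q ∈ Metric.closedBall p r, W q ≤ 0) :
    ∃ Ξ : Set E, IsOpen Ξ ∧ p ∈ Ξ ∧ ∀ x : ℝ → E, ContinuousOn x (Set.Ici 0) →
      (∀ T > 0, (∀ t ∈ Set.Icc 0 T, x t ∈ Metric.closedBall p r) →
        ∀ t ∈ Set.Ioo 0 T, HasDerivAt x (F (x t)) t) →
      x 0 ∈ Ξ → ∀ t ≥ 0, x t ∈ Metric.closedBall p r := by
  -- The level `m` is the minimum of `U` on the sphere; in dimension 0 the sphere is empty and any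
  -- larger value serves.
  obtain ⟨m, hpm, hm⟩ : ∃ m, U p < m ∧ ∀ q ∈ Metric.sphere p r, m ≤ U q := by
    rcases (Metric.sphere p r).eq_empty_or_nonempty with he | hne
    · exact ⟨U p + 1, by linarith, by simp [he]⟩
    · obtain ⟨q, hq, hqm⟩ := (isCompact_sphere p r).exists_isMinOn hne
        (hU.mono Metric.sphere_subset_closedBall)
      refine ⟨U q, hmin q (Metric.sphere_subset_closedBall hq) ?_, fun q' hq' => hqm hq'⟩
      rintro rfl
      rw [Metric.mem_sphere, dist_self] at hq
      exact hr.ne hq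
  refine ⟨Metric.ball p r ∩ U ⁻¹' Set.Iio m,
    (hU.mono Metric.ball_subset_closedBall).isOpen_inter_preimage Metric.isOpen_ball isOpen_Iio,
    ⟨Metric.mem_ball_self hr, hpm⟩, fun x hxc hx hx0 => ?_⟩
  by_contra! hcon
  obtain ⟨b, hb0, hb⟩ := hcon
  have hdist : ContinuousOn (fun t => dist (x t) p) (Set.Ici 0) :=
    (continuous_id.dist continuous_const).comp_continuousOn hxc
  -- First time on the sphere: the trajectory is in the closed ball up to `τ`, so the equation holds
  -- there, `U` cannot have risen, and `m` is out of reach.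
  obtain ⟨τ, ⟨⟨hτ0, hτb⟩, hτr⟩, hτmin⟩ : ∃ τ, IsLeast (Set.Icc 0 b ∩ {t | r ≤ dist (x t) p}) τ := by
    refine IsCompact.exists_isLeast ?_ ⟨b, ⟨hb0, le_rfl⟩, ?_⟩
    · refine isCompact_Icc.of_isClosed_subset ?_ Set.inter_subset_left
      exact (hdist.mono Set.Icc_subset_Ici_self).preimage_isClosed_of_isClosed isClosed_Icc
        isClosed_Ici
    · exact (not_le.1 (Metric.mem_closedBall.not.1 hb)).le
  have hlt : ∀ t, 0 ≤ t → t < τ → dist (x t) p < r := fun t ht htτ => by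
    by_contra! h
    exact absurd (hτmin ⟨⟨ht, htτ.le.trans hτb⟩, h⟩) (not_le.2 htτ)
  have hτpos : 0 < τ := by
    rcases hτ0.eq_or_lt with h | h
    · exact absurd hx0.1 (by rw [Metric.mem_ball, h]; exact not_lt.2 hτr)
    · exact h
  have hτle : dist (x τ) p ≤ r := by
    refine ContinuousWithinAt.closure_le (s := Set.Ico 0 τ) (f := fun t => dist (x t) p) (x := τ)
      (g := fun _ => r) ?_ ?_ continuousWithinAt_const fun t ht => (hlt t ht.1 ht.2).le
    · rw [closure_Ico hτpos.ne]; exact ⟨hτ0, le_rfl⟩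
    · exact (hdist τ hτ0).mono fun t ht => ht.1
  have hball : ∀ t ∈ Set.Icc 0 τ, x t ∈ Metric.closedBall p r := fun t ht => by
    rcases ht.2.eq_or_lt with h | h
    · rw [h]; exact hτle
    · exact (hlt t ht.1 h).le
  have hanti : AntitoneOn (fun t => U (x t)) (Set.Icc 0 τ) := by
    refine antitoneOn_of_hasDerivWithinAt_nonpos (f' := fun t => W (x t)) (convex_Icc 0 τ)
      (hU.comp (hxc.mono Set.Icc_subset_Ici_self) hball) ?_ ?_ <;>
    rw [interior_Icc] <;> intro t ht
    · exact (hderiv x t (hball t (Set.Ioo_subset_Icc_self ht))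
        (hx τ hτpos hball t ht)).hasDerivWithinAt
    · exact hW _ (hball t (Set.Ioo_subset_Icc_self ht))
  have h1 := hanti ⟨le_rfl, hτ0⟩ ⟨hτ0, le_rfl⟩ hτ0
  have h2 := hm (x τ) (le_antisymm hτle hτr)
  have h3 : U (x 0) < m := hx0.2
  simp only at h1
  linarith

/-- Along a bounded trajectory the derivative of a nonincreasing function tends to zero. -/
theorem tendsto_lyapunov_deriv_zero {E : Type*} [NormedAddCommGroup E]
    [NormedSpace ℝ E] {F : E → E} {U W : E → ℝ} {x : ℝ → E} {K : Set E}
    (hK : IsCompact K) (hF : ContinuousOn F K) (hU : ContinuousOn U K) (hWc : ContinuousOn W K)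
    (hW : ∀ q ∈ K, W q ≤ 0) (hxK : ∀ t > 0, x t ∈ K)
    (hx : ∀ t > 0, HasDerivAt x (F (x t)) t)
    (hderiv : ∀ t > 0, HasDerivAt (fun s => U (x s)) (W (x t)) t) :
    Tendsto (fun t => W (x t)) atTop (𝓝 0) := by
  obtain ⟨C, hC⟩ := hK.exists_bound_of_continuousOn hU
  have hpos : ∀ t ∈ Set.Ici (1 : ℝ), 0 < t := fun t ht => zero_lt_one.trans_le ht
  obtain ⟨l, hl⟩ := AntitoneOn.exists_tendsto_atTop (F := fun t => U (x t)) (a := 1) (m := -C)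
    (antitoneOn_of_hasDerivWithinAt_nonpos (f' := fun t => W (x t)) (convex_Ici 1)
      (fun t ht => (hderiv t (hpos t ht)).continuousAt.continuousWithinAt)
      (fun t ht => (hderiv t (hpos t (interior_subset ht))).hasDerivWithinAt)
      (fun t ht => hW _ (hxK t (hpos t (interior_subset ht)))))
    (fun t ht => (abs_le.1 (hC _ (hxK t (hpos t ht)))).1)
  exact tendsto_deriv_zero_of_uniformContinuousOn hderiv
    (uniformContinuousOn_comp_of_hasDerivAt hK hF hWc hxK hx) hl

/-! ### Limit sets of asymptotically autonomous equations -/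

/-- Grönwall estimate: a solution of a Lipschitz equation depends continuously on the initial
value and on a perturbation of the vector field. -/
theorem tendsto_of_tendsto_perturbation {X ι : Type*} [NormedAddCommGroup X]
    [NormedSpace ℝ X] {l : Filter ι} {v : X → X} {K : NNReal} (hv : LipschitzWith K v)
    {s : ℝ} (hs : 0 ≤ s) {y y' : ι → ℝ → X} {γ : ℝ → X}
    (hγ : ∀ σ, HasDerivAt γ (v (γ σ)) σ)
    (hy : ∀ᶠ t in l, ∀ σ ∈ Set.Icc 0 s, HasDerivAt (y t) (y' t σ) σ)
    (hy' : ∀ ε > 0, ∀ᶠ t in l, ∀ σ ∈ Set.Icc 0 s, dist (y' t σ) (v (y t σ)) ≤ ε)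
    (h0 : Tendsto (fun t => y t 0) l (𝓝 (γ 0))) :
    Tendsto (fun t => y t s) l (𝓝 (γ s)) := by
  have hbound : Tendsto (fun ε : ℝ => gronwallBound ε K ε s) (𝓝[>] 0) (𝓝 0) := by
    have hcont : Continuous fun ε : ℝ => gronwallBound ε K ε s := by
      unfold gronwallBound
      split_ifs <;> fun_prop
    have := hcont.tendsto 0
    rw [gronwallBound_ε0_δ0] at this
    exact this.mono_left nhdsWithin_le_nhds
  rw [Metric.tendsto_nhds]
  intro ε hε
  obtain ⟨δ, hδε, hδ⟩ := ((hbound.eventually (gt_mem_nhds hε)).and self_mem_nhdsWithin).exists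
  filter_upwards [hy, hy' δ hδ, Metric.tendsto_nhds.1 h0 δ hδ] with t h1 h2 h3
  have := dist_le_of_approx_trajectories_ODE (v := fun _ => v) (f := y t) (g := γ) (f' := y' t)
    (g' := fun σ => v (γ σ)) (a := 0) (b := s) (εf := δ) (εg := 0) (δ := δ) (fun _ => hv)
    (fun σ hσ => (h1 σ hσ).continuousAt.continuousWithinAt)
    (fun σ hσ => (h1 σ (Set.Ico_subset_Icc_self hσ)).hasDerivWithinAt)
    (fun σ hσ => h2 σ (Set.Ico_subset_Icc_self hσ))
    (fun σ _ => (hγ σ).continuousAt.continuousWithinAt)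
    (fun σ _ => (hγ σ).hasDerivWithinAt) (by simp) h3.le s ⟨hs, le_rfl⟩
  rw [add_zero, sub_zero] at this
  exact this.trans_lt hδε

/-- The set of cluster points of a solution of `x' = f x (u t)`, with an input `u` that tends to a
constant, is invariant under the limiting equation. -/
theorem isInvariantSet_setOf_mapClusterPt {X : Type*} [NormedAddCommGroup X] [NormedSpace ℝ X]
    {f : X → ℝ → X} {K : NNReal} (hf : LipschitzWith K fun p : X × ℝ => f p.1 p.2)
    {u : ℝ → ℝ} {u₀ : ℝ} (hu : Tendsto u atTop (𝓝 u₀)) {x : ℝ → X}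
    (hx : ∀ t > 0, HasDerivAt x (f (x t) (u t)) t) :
    IsInvariantSet (fun q => f q u₀) {q | MapClusterPt q atTop x} := by
  intro γ hγ hγ0 s
  obtain ⟨𝒰, h𝒰, hx0⟩ := mapClusterPt_iff_ultrafilter.1 hγ0
  have hv : LipschitzWith K fun q => f q u₀ := by
    have := hf.comp (LipschitzWith.prodMk_right (β := ℝ) (α := X) u₀)
    simpa using! this
  have hdist : ∀ q a, dist (f q a) (f q u₀) ≤ K * dist a u₀ := fun q a => by
    simpa [Prod.dist_eq] using hf.dist_le_mul (q, a) (q, u₀)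
  have hKu : ∀ ε > 0, ∀ᶠ t in atTop, ↑K * dist (u t) u₀ ≤ ε := fun ε hε => by
    have : Tendsto (fun t => ↑K * dist (u t) u₀) atTop (𝓝 0) := by
      simpa using (tendsto_iff_dist_tendsto_zero.1 hu).const_mul (K : ℝ)
    exact (this.eventually (gt_mem_nhds hε)).mono fun t ht => ht.le
  -- Grönwall runs forward only; the sign `c` = -1 reverses time and covers negative `s`. All times
  -- involved are at least `t - s`, hence eventually in the range where the equation holds.
  have key : ∀ c : ℝ, (c = 1 ∨ c = -1) → ∀ s ≥ 0,
      Tendsto (fun t => x (t + c * s)) 𝒰 (𝓝 (γ (c * s))) := by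
    intro c hc s hs
    have hcabs : |c| = 1 := by rcases hc with rfl | rfl <;> simp
    have hlow : ∀ σ ∈ Set.Icc 0 s, -s ≤ c * σ := fun σ hσ => by
      rcases hc with rfl | rfl <;> linarith [hσ.1, hσ.2]
    refine tendsto_of_tendsto_perturbation (v := fun q => c • f q u₀) (K := K)
      (y := fun t σ => x (t + c * σ)) (γ := fun σ => γ (c * σ))
      (y' := fun t σ => c • f (x (t + c * σ)) (u (t + c * σ))) ?_ hs ?_ ?_ ?_ ?_
    · refine LipschitzWith.of_dist_le_mul fun a b => ?_
      rw [dist_smul₀, Real.norm_eq_abs, hcabs, one_mul]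
      exact hv.dist_le_mul a b
    · intro σ
      exact (hγ (c * σ)).scomp σ (by simpa using (hasDerivAt_id σ).const_mul c)
    · refine h𝒰 ?_
      filter_upwards [eventually_gt_atTop s] with t ht σ hσ
      refine (hx (t + c * σ) (by linarith [hlow σ hσ])).scomp σ ?_
      simpa using ((hasDerivAt_id σ).const_mul c).const_add t
    · intro ε hε
      refine h𝒰 ?_
      obtain ⟨T, hT⟩ := eventually_atTop.1 (hKu ε hε)
      filter_upwards [eventually_ge_atTop (T + s)] with t ht σ hσ
      rw [dist_smul₀, Real.norm_eq_abs, hcabs, one_mul]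
      exact (hdist _ _).trans (hT _ (by linarith [hlow σ hσ]))
    · simpa using! hx0
  have hshift : Tendsto (fun t => x (t + s)) 𝒰 (𝓝 (γ s)) := by
    rcases le_total 0 s with hs | hs
    · simpa using key 1 (Or.inl rfl) s hs
    · simpa using key (-1) (Or.inr rfl) (-s) (by linarith)
  have hmap : Tendsto (fun t : ℝ => t + s) 𝒰 atTop :=
    (tendsto_atTop_add_const_right atTop s tendsto_id).mono_left h𝒰
  exact (hshift.mapClusterPt).of_comp hmap

/-- The graph of the cosine lies strictly below its tangents on `[-π/2, π/2]`. -/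
theorem Real.cos_lt_tangent {a b : ℝ} (ha : |a| < Real.pi / 2) (hb : |b| < Real.pi / 2)
    (hab : b ≠ a) : 0 < Real.cos a - Real.cos b - Real.sin a * (b - a) := by
  have ha' : a ∈ Set.Icc (-(Real.pi / 2)) (Real.pi / 2) := abs_le.1 ha.le
  have hb' : b ∈ Set.Icc (-(Real.pi / 2)) (Real.pi / 2) := abs_le.1 hb.le
  rcases hab.lt_or_gt with h | h
  · have := strictConcaveOn_cos_Icc.lt_slope_of_hasDerivAt hb' ha' h (Real.hasDerivAt_cos a)
    rw [slope_def_field, lt_div_iff₀ (sub_pos.2 h)] at this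
    linarith
  · have := strictConcaveOn_cos_Icc.slope_lt_of_hasDerivAt ha' hb' h (Real.hasDerivAt_cos a)
    rw [slope_def_field, div_lt_iff₀ (sub_pos.2 h)] at this
    linarith

/-! ### The network at nominal load -/

noncomputable section

namespace PowerNetwork

variable {N : Type*} (P : PowerNetwork N)

theorem continuous_f_comp {Y : Type*} [TopologicalSpace Y] (j : N)
    {a : Y → EuclideanSpace ℝ (Fin (P.n j))} {b : Y → ℝ} (ha : Continuous a) (hb : Continuous b) :
    Continuous fun y => P.f j (a y) (b y) := by
  obtain ⟨K, hK⟩ := P.f_lipschitz j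
  exact hK.continuous.comp (ha.prodMk hb)

theorem continuous_g_comp {Y : Type*} [TopologicalSpace Y] (j : N)
    {a : Y → EuclideanSpace ℝ (Fin (P.n j))} {b : Y → ℝ} (ha : Continuous a) (hb : Continuous b) :
    Continuous fun y => P.g j (a y) (b y) := by
  obtain ⟨K, hK⟩ := P.g_lipschitz j
  exact hK.continuous.comp (ha.prodMk hb)

/-- Constancy of a function on the buses that agrees at the ends of each line. -/
theorem eq_of_forall_line {α : Type*} {w : N → α} (hw : ∀ e : P.E, w e.1.1 = w e.1.2) (i j : N) :
    w i = w j := by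
  obtain ⟨p⟩ := P.connected.preconnected i j
  induction p with
  | nil => rfl
  | cons h _ ih =>
    rw [← ih]
    rcases ((SimpleGraph.fromRel_adj _ _ _).1 h).2 with h | h
    · exact hw ⟨_, h⟩
    · exact (hw ⟨_, h⟩).symm

theorem filippovLoad_of_mem_Ioo {j : N} {w : ℝ} (hw : w ∈ Set.Ioo (P.ωLow j) (P.ωHigh j)) :
    P.filippovLoad j w = {0} := by
  simp [filippovLoad, onOffLoad, hw.1, hw.2.ne, hw.1.ne', hw.2.le]

theorem zero_mem_Ioo (j : N) : (0 : ℝ) ∈ Set.Ioo (P.ωLow j) (P.ωHigh j) :=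
  ⟨P.ωLow_neg j, P.ωHigh_pos j⟩

section nominal

variable [DecidableEq N]

/-- The power surplus at bus `j` when the on-off load has its nominal value. -/
def surplus (x : P.State) (j : N) : ℝ :=
  -P.pL j + P.g j (x.2.2 j) (-x.2.1 j) - (∑ e : P.E with e.1.1 = j, P.lineFlow x.1 e)
    + ∑ e : P.E with e.1.2 = j, P.lineFlow x.1 e

/-- The right-hand side of the network dynamics when all on-off loads have their nominal value. -/
def nominalField (x : P.State) : P.State :=
  (fun e => x.2.1 e.1.1 - x.2.1 e.1.2, fun j => 1 / P.M j * P.surplus x j,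
    fun j => P.f j (x.2.2 j) (-x.2.1 j))

/-- Strictly between the thresholds the only admissible load is 0, so the set-valued field has a
single value. -/
theorem mem_Q_iff_eq_nominalField {x z : P.State}
    (hx : ∀ j, x.2.1 j ∈ Set.Ioo (P.ωLow j) (P.ωHigh j)) : z ∈ P.Q x ↔ z = P.nominalField x := by
  have hload : ∀ j, P.filippovLoad j (x.2.1 j) = {0} := fun j => P.filippovLoad_of_mem_Ioo (hx j)
  constructor
  · rintro ⟨h1, h2, h3⟩
    refine Prod.ext (funext h1) (Prod.ext (funext fun j => ?_) (funext h3))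
    obtain ⟨v, hv, h⟩ := h2 j
    rw [hload j, Set.mem_singleton_iff] at hv
    rw [h, hv, sub_zero]
    rfl
  · rintro rfl
    refine ⟨fun _ => rfl, fun j => ⟨0, by rw [hload j]; rfl, ?_⟩, fun _ => rfl⟩
    rw [sub_zero]
    rfl

theorem continuous_surplus (j : N) : Continuous fun x : P.State => P.surplus x j := by
  have := P.continuous_g_comp j (a := fun x : P.State => x.2.2 j) (b := fun x => -x.2.1 j)
    (by fun_prop) (by fun_prop)
  unfold surplus lineFlow
  fun_prop

theorem continuous_nominalField : Continuous P.nominalField := by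
  refine Continuous.prodMk (by fun_prop) (Continuous.prodMk ?_ ?_)
  · exact continuous_pi fun j => (P.continuous_surplus j).const_mul _
  · exact continuous_pi fun j => P.continuous_f_comp j (by fun_prop) (by fun_prop)

/-- Equilibria run at the nominal frequency if one bus can only rest at it. -/
theorem frequency_eq_zero_of_mem_equilibria (hnom : P.NominalFrequencyBus) {x : P.State}
    (hx : x ∈ P.equilibria) : x.2.1 = 0 := by
  obtain ⟨h1, -, h3⟩ := hx
  obtain ⟨j, hj⟩ := hnom
  have hj0 : x.2.1 j = 0 := hj _ _ (h3 j).symm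
  funext i
  rw [P.eq_of_forall_line (fun e => (sub_eq_zero.1 (h1 e).symm)) i j, hj0]
  rfl

/-- Equilibria at the nominal frequency. -/
theorem mem_equilibria_iff_of_frequency_eq_zero {x : P.State} (hx : x.2.1 = 0) :
    x ∈ P.equilibria ↔ (∀ j, P.surplus x j = 0) ∧ ∀ j, P.f j (x.2.2 j) 0 = 0 := by
  have h : x ∈ P.equilibria ↔ P.nominalField x = 0 :=
    (P.mem_Q_iff_eq_nominalField fun j => by rw [hx]; exact P.zero_mem_Ioo j).trans eq_comm
  rw [h]
  have hM : ∀ j, P.M j ≠ 0 := fun j => (P.M_pos j).ne'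
  simp [Prod.ext_iff, funext_iff, nominalField, hx, hM]

end nominal

/-! ### The energy function -/

section Lyapunov

/-- The contribution of bus `j` to the derivative of the energy along solutions. -/
def dissipation (xStar : P.State) (V : ∀ j, EuclideanSpace ℝ (Fin (P.n j)) → ℝ) (x : P.State)
    (j : N) : ℝ :=
  x.2.1 j * (P.g j (x.2.2 j) (-x.2.1 j) - P.g j (xStar.2.2 j) 0)
    + fderiv ℝ (V j) (x.2.2 j) (P.f j (x.2.2 j) (-x.2.1 j))

theorem continuousOn_dissipation (xStar : P.State)
    {V : ∀ j, EuclideanSpace ℝ (Fin (P.n j)) → ℝ} {K : Set P.State} {j : N}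
    (hV : ContinuousOn (fun x : P.State => fderiv ℝ (V j) (x.2.2 j)) K) :
    ContinuousOn (fun x => P.dissipation xStar V x j) K := by
  refine ContinuousOn.add (Continuous.continuousOn ?_) (hV.clm_apply (Continuous.continuousOn ?_))
  · have := P.continuous_g_comp j (a := fun x : P.State => x.2.2 j) (b := fun x => -x.2.1 j)
      (by fun_prop) (by fun_prop)
    fun_prop
  · exact P.continuous_f_comp j (by fun_prop) (by fun_prop)

variable [Fintype N]

/-- The Lyapunov function: kinetic energy, Bregman distance of the potential energy of the lines
and storage functions of the supply. -/
def energy (xStar : P.State) (V : ∀ j, EuclideanSpace ℝ (Fin (P.n j)) → ℝ) (x : P.State) : ℝ :=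
  ∑ e : P.E, P.B e * (Real.cos (xStar.1 e) - Real.cos (x.1 e)
      - Real.sin (xStar.1 e) * (x.1 e - xStar.1 e))
    + ∑ j, (P.M j / 2 * x.2.1 j ^ 2 + V j (x.2.2 j))

/-- Each line has exactly one endpoint of the kind selected by `s`, so the sum over buses regroups
into a sum over lines. -/
theorem sum_mul_sum_filter [DecidableEq N] (w : N → ℝ) (a : P.E → ℝ) (s : P.E → N) :
    ∑ j, w j * ∑ e : P.E with s e = j, a e = ∑ e : P.E, w (s e) * a e := by
  rw [← Finset.sum_fiberwise Finset.univ s]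
  refine Finset.sum_congr rfl fun j _ => ?_
  rw [Finset.mul_sum]
  refine Finset.sum_congr rfl fun e he => ?_
  rw [(Finset.mem_filter.1 he).2]

/-- Subtracting the power balance at `xStar` turns line flows into the differences B (sin η - sin
η*). These are the gradient of the Bregman term, whose rate therefore cancels the line part of the
kinetic power. -/
theorem hasDerivAt_energy [DecidableEq N] {xStar : P.State} (hω : xStar.2.1 = 0)
    (heq : ∀ j, P.surplus xStar j = 0) {V : ∀ j, EuclideanSpace ℝ (Fin (P.n j)) → ℝ}
    {γ : ℝ → P.State} {t : ℝ} (hV : ∀ j, DifferentiableAt ℝ (V j) ((γ t).2.2 j))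
    (hγ : HasDerivAt γ (P.nominalField (γ t)) t) :
    HasDerivAt (fun s => P.energy xStar V (γ s)) (∑ j, P.dissipation xStar V (γ t) j) t := by
  have h1 : ∀ e : P.E, HasDerivAt (fun s => (γ s).1 e) ((P.nominalField (γ t)).1 e) t :=
    hasDerivAt_pi.1 hγ.fst
  have h2 : ∀ j, HasDerivAt (fun s => (γ s).2.1 j) ((P.nominalField (γ t)).2.1 j) t :=
    hasDerivAt_pi.1 hγ.snd.fst
  have h3 : ∀ j, HasDerivAt (fun s => (γ s).2.2 j) ((P.nominalField (γ t)).2.2 j) t :=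
    hasDerivAt_pi.1 hγ.snd.snd
  have hsum := (HasDerivAt.fun_sum (u := Finset.univ) fun (e : P.E) _ =>
      ((((h1 e).cos.const_sub (Real.cos (xStar.1 e))).fun_sub
        (((h1 e).sub_const (xStar.1 e)).const_mul (Real.sin (xStar.1 e)))).const_mul
          (P.B e))).fun_add
    (HasDerivAt.fun_sum (u := Finset.univ) fun (j : N) _ =>
      (((h2 j).fun_pow 2).const_mul (P.M j / 2)).fun_add
        ((hV j).hasFDerivAt.comp_hasDerivAt t (h3 j)))
  refine HasDerivAt.congr_deriv hsum ?_
  have hM : ∀ j, P.M j ≠ 0 := fun j => (P.M_pos j).ne'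
  have hbus : ∀ j, (γ t).2.1 j * P.surplus (γ t) j =
      (γ t).2.1 j * (P.g j ((γ t).2.2 j) (-(γ t).2.1 j) - P.g j (xStar.2.2 j) 0)
      - (γ t).2.1 j * (∑ e : P.E with e.1.1 = j, (P.lineFlow (γ t).1 e - P.lineFlow xStar.1 e))
      + (γ t).2.1 j * ∑ e : P.E with e.1.2 = j, (P.lineFlow (γ t).1 e - P.lineFlow xStar.1 e) := by
    intro j
    have := heq j
    simp only [surplus, hω, Pi.zero_apply, neg_zero] at this
    simp only [surplus, Finset.sum_sub_distrib]
    linear_combination (γ t).2.1 j * this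
  have hlines : ∑ j, (γ t).2.1 j * P.surplus (γ t) j =
      ∑ j, (γ t).2.1 j * (P.g j ((γ t).2.2 j) (-(γ t).2.1 j) - P.g j (xStar.2.2 j) 0)
      - ∑ e : P.E, ((γ t).2.1 e.1.1 - (γ t).2.1 e.1.2)
        * (P.lineFlow (γ t).1 e - P.lineFlow xStar.1 e) := by
    simp only [hbus, Finset.sum_add_distrib, Finset.sum_sub_distrib (f := fun j => (γ t).2.1 j * _),
      sub_mul _ _ (P.lineFlow _ _ - _)]
    rw [P.sum_mul_sum_filter (γ t).2.1 _ fun e => e.1.1,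
      P.sum_mul_sum_filter (γ t).2.1 _ fun e => e.1.2, Finset.sum_sub_distrib]
    ring
  have hkin : ∀ j, P.M j / 2 * (((2 : ℕ) : ℝ) * (γ t).2.1 j ^ (2 - 1) * (P.nominalField (γ t)).2.1 j)
      = (γ t).2.1 j * P.surplus (γ t) j := by
    intro j
    simp only [nominalField]
    have := hM j
    field_simp
    norm_num
    ring
  simp only [hkin, Finset.sum_add_distrib, hlines, dissipation]
  rw [← add_assoc]
  refine congrArg₂ (· + ·) ?_ rfl
  rw [add_sub_left_comm, add_eq_left, sub_eq_zero]
  refine Finset.sum_congr rfl fun e _ => ?_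
  simp only [nominalField, lineFlow]
  ring

/-- Strictness comes from strict concavity of the cosine if some angle differs, and otherwise from a
nonzero frequency or a storage function. -/
theorem energy_lt_energy {xStar x : P.State} (hω : xStar.2.1 = 0)
    {V : ∀ j, EuclideanSpace ℝ (Fin (P.n j)) → ℝ} (hstar : ∀ e, |xStar.1 e| < Real.pi / 2)
    (hx : ∀ e, |x.1 e| < Real.pi / 2)
    (hV : ∀ j, x.2.2 j ≠ xStar.2.2 j → V j (xStar.2.2 j) < V j (x.2.2 j)) (hne : x ≠ xStar) :
    P.energy xStar V xStar < P.energy xStar V x := by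
  have hline : ∀ e, 0 ≤ P.B e * (Real.cos (xStar.1 e) - Real.cos (x.1 e)
      - Real.sin (xStar.1 e) * (x.1 e - xStar.1 e)) := fun e => by
    by_cases h : x.1 e = xStar.1 e
    · simp [h]
    · exact (mul_pos (P.B_pos e) (Real.cos_lt_tangent (hstar e) (hx e) h)).le
  have hVle : ∀ j, V j (xStar.2.2 j) ≤ V j (x.2.2 j) := fun j => by
    by_cases h : x.2.2 j = xStar.2.2 j
    · rw [h]
    · exact (hV j h).le
  have hkin : ∀ j, 0 ≤ P.M j / 2 * x.2.1 j ^ 2 := fun j => by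
    have := P.M_pos j
    positivity
  have hbus : ∀ j, V j (xStar.2.2 j) ≤ P.M j / 2 * x.2.1 j ^ 2 + V j (x.2.2 j) := fun j => by
    linarith [hkin j, hVle j]
  have hstarE : P.energy xStar V xStar = ∑ j, V j (xStar.2.2 j) := by
    simp [energy, hω]
  rw [hstarE, energy]
  by_cases h1 : x.1 = xStar.1
  · have : ∑ j, V j (xStar.2.2 j) < ∑ j, (P.M j / 2 * x.2.1 j ^ 2 + V j (x.2.2 j)) := by
      refine Finset.sum_lt_sum (fun j _ => hbus j) ?_
      by_contra! hcon
      refine hne (Prod.ext h1 (Prod.ext (funext fun j => ?_) (funext fun j => ?_)))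
      · rw [hω]
        have h := hcon j (Finset.mem_univ j)
        have hz : P.M j / 2 * x.2.1 j ^ 2 = 0 := le_antisymm (by linarith [hVle j]) (hkin j)
        simpa [(P.M_pos j).ne'] using hz
      · by_contra h
        linarith [hV j h, hcon j (Finset.mem_univ j), hkin j]
    linarith [Finset.sum_nonneg fun e (_ : e ∈ (Finset.univ : Finset P.E)) => hline e]
  · obtain ⟨e, he⟩ := Function.ne_iff.1 h1
    have hpos := Finset.sum_pos' (fun e (_ : e ∈ (Finset.univ : Finset P.E)) => hline e)
      ⟨e, Finset.mem_univ e, mul_pos (P.B_pos e) (Real.cos_lt_tangent (hstar e) (hx e) he)⟩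
    linarith [Finset.sum_le_sum fun j (_ : j ∈ (Finset.univ : Finset N)) => hbus j]

theorem continuousOn_energy (xStar : P.State) {V : ∀ j, EuclideanSpace ℝ (Fin (P.n j)) → ℝ}
    {K : Set P.State} (hV : ∀ j, ContinuousOn (fun x : P.State => V j (x.2.2 j)) K) :
    ContinuousOn (P.energy xStar V) K := by
  refine ContinuousOn.add (Continuous.continuousOn (by fun_prop)) ?_
  refine continuousOn_finsetSum _ fun j _ => ContinuousOn.add ?_ (hV j)
  exact Continuous.continuousOn (by fun_prop)

end Lyapunov

/-! ### Limit points and Filippov solutions -/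

variable [Fintype N] [DecidableEq N]

/-- The cluster points of a bounded solution are equilibria if the loads are nominal and the
frequencies tend to zero. -/
theorem mem_equilibria_of_mapClusterPt (hreg : P.SupplyRegularity) {x : ℝ → P.State}
    {K : Set P.State} (hK : IsCompact K) (hxK : ∀ t > 0, x t ∈ K)
    (hx : ∀ t > 0, HasDerivAt x (P.nominalField (x t)) t)
    (hω : Tendsto (fun t => (x t).2.1) atTop (𝓝 0)) {p : P.State} (hpK : p ∈ K)
    (hp : MapClusterPt p atTop x) : p ∈ P.equilibria := by
  have hxK' : ∀ᶠ t in atTop, x t ∈ K := (eventually_gt_atTop 0).mono hxK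
  have hωj : ∀ j, Tendsto (fun t => (x t).2.1 j) atTop (𝓝 0) := tendsto_pi_nhds.1 hω
  have hFc := P.continuous_nominalField
  have hp0 : p.2.1 = 0 := hp.eq_of_tendsto hpK hxK'
    (show Continuous fun q : P.State => q.2.1 by fun_prop).continuousOn hω
  refine (P.mem_equilibria_iff_of_frequency_eq_zero hp0).2 ⟨fun j => ?_, fun j => ?_⟩
  · have hj : Continuous fun q => (P.nominalField q).2.1 j :=
      (continuous_apply j).comp (continuous_fst.comp (continuous_snd.comp hFc))
    -- Barbalat for the frequency itself: ω j → 0 with uniformly continuous derivative, so the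
    -- acceleration vanishes at cluster points.
    have h0 : (P.nominalField p).2.1 j = 0 := hp.eq_of_tendsto hpK hxK' hj.continuousOn
      (tendsto_deriv_zero_of_uniformContinuousOn
        (fun t ht => hasDerivAt_pi.1 (hx t ht).snd.fst j)
        (uniformContinuousOn_comp_of_hasDerivAt (a := fun q => (P.nominalField q).2.1 j) hK
          hFc.continuousOn hj.continuousOn hxK hx)
        (hωj j))
    simpa [nominalField, (P.M_pos j).ne'] using h0
  · obtain ⟨L, hL⟩ := P.f_lipschitz j
    have hproj : Continuous fun q : P.State => q.2.2 j := by fun_prop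
    have hinv := isInvariantSet_setOf_mapClusterPt hL
      (by simpa using (hωj j).neg : Tendsto (fun t => -(x t).2.1 j) atTop (𝓝 (-0)))
      (x := fun t => (x t).2.2 j) fun t ht => hasDerivAt_pi.1 (hx t ht).snd.snd j
    have hcomp : IsCompact {q | MapClusterPt q atTop fun t => (x t).2.2 j} := by
      refine (hK.image hproj).of_isClosed_subset isClosed_setOfPred_clusterPt fun q hq => ?_
      obtain ⟨𝒰, h𝒰, hq⟩ := mapClusterPt_iff_ultrafilter.1 hq
      exact (hK.image hproj).isClosed.mem_of_tendsto hq
        (h𝒰 (hxK'.mono fun t ht => Set.mem_image_of_mem _ ht))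
    have := (hreg j).2 0 _ hcomp hinv (p.2.2 j) (hp.continuousAt_comp hproj.continuousAt)
    simpa using this

theorem IsFilippovSolution.continuousOn {x : ℝ → P.State} (hx : P.IsFilippovSolution x) :
    ContinuousOn x (Set.Ici 0) := by
  intro t ht
  have h0 : (0 : ℝ) ≤ t + 1 := by linarith [Set.mem_Ici.1 ht]
  have := (hx.1 (t + 1) h0).continuousOn
  rw [Set.uIcc_of_le h0] at this
  refine (this t ⟨ht, by linarith⟩).mono_of_mem_nhdsWithin ?_
  rw [← Set.Ici_inter_Iic]
  exact inter_mem_nhdsWithin _ (Iic_mem_nhds (by linarith))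

/-- Here the inclusion is an a.e. equation with continuous right-hand side along the solution, which
upgrades to every interior time. -/
theorem IsFilippovSolution.hasDerivAt {x : ℝ → P.State} (hx : P.IsFilippovSolution x) {T : ℝ}
    (hT : 0 < T)
    (hω : ∀ t ∈ Set.Icc 0 T, ∀ j, (x t).2.1 j ∈ Set.Ioo (P.ωLow j) (P.ωHigh j)) :
    ∀ t ∈ Set.Ioo 0 T, HasDerivAt x (P.nominalField (x t)) t := by
  refine (hx.1 T hT.le).hasDerivAt_of_ae_hasDerivAt hT.le
    (P.continuous_nominalField.comp_continuousOn
      (hx.continuousOn.mono Set.Icc_subset_Ici_self)) ?_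
  filter_upwards [hx.2] with t ht htT
  obtain ⟨z, hz, hd⟩ := ht htT.1
  rwa [(P.mem_Q_iff_eq_nominalField (hω t (Set.Ioo_subset_Icc_self htT))).1 hz] at hd

end PowerNetwork

end

/-! ### Local convergence -/

theorem theorem1 {N : Type*} [Fintype N] [DecidableEq N] (P : PowerNetwork N)
    (hreg : P.SupplyRegularity) (hnom : P.NominalFrequencyBus)
    (xStar : P.State) (heq : xStar ∈ P.equilibria) (hpass : P.LocallyPassiveAt xStar)
    (hangle : ∀ e : P.E, |xStar.1 e| < Real.pi / 2) :
    xStar.2.1 = 0 ∧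
      ∃ Ξ : Set P.State, IsOpen Ξ ∧ xStar ∈ Ξ ∧
        ∀ x : ℝ → P.State, P.IsFilippovSolution x → x 0 ∈ Ξ →
          Tendsto (fun t => Metric.infDist (x t) P.equilibria) atTop (𝓝 0) ∧
            Tendsto (fun t => (x t).2.1) atTop (𝓝 0) := by
  have hω := P.frequency_eq_zero_of_mem_equilibria hnom heq
  refine ⟨hω, ?_⟩
  choose V hV using hpass
  choose Ω Y φ hΩ hΩmem hY hYmem hφ hVc hVnonneg hVdiss using fun j => (hV j).1
  simp only [hω, Pi.zero_apply, neg_zero, sub_zero] at hΩmem hVdiss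
  have hsurplus := ((P.mem_equilibria_iff_of_frequency_eq_zero hω).1 heq).1
  -- One radius on which all local hypotheses hold at every bus and line: small angles, nominal
  -- loads, passivity, strict minimum of the storage.
  obtain ⟨r, hr, hball⟩ : ∃ r > 0, ∀ ⦃x⦄, x ∈ Metric.closedBall xStar r →
      (∀ e, |x.1 e| < Real.pi / 2) ∧ (∀ j, x.2.1 j ∈ Set.Ioo (P.ωLow j) (P.ωHigh j)) ∧
      (∀ j, -x.2.1 j ∈ Ω j) ∧ (∀ j, x.2.2 j ∈ Y j) ∧
      ∀ j, x.2.2 j ≠ xStar.2.2 j → V j (xStar.2.2 j) < V j (x.2.2 j) := by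
    refine Metric.nhds_basis_closedBall.eventually_iff.1 ?_
    have h0 : ∀ j, xStar.2.1 j = 0 := fun j => by rw [hω]; rfl
    refine (eventually_all.2 fun e => ?_).and ((eventually_all.2 fun j => ?_).and
      ((eventually_all.2 fun j => ?_).and ((eventually_all.2 fun j => ?_).and
      (eventually_all.2 fun j => ?_))))
    · exact (show Continuous fun x : P.State => |x.1 e| by fun_prop).continuousAt.eventually_lt_const
        (hangle e)
    · exact (show Continuous fun x : P.State => x.2.1 j by fun_prop).continuousAt.eventually_mem
        (isOpen_Ioo.mem_nhds (by rw [h0]; exact P.zero_mem_Ioo j))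
    · exact (show Continuous fun x : P.State => -x.2.1 j by fun_prop).continuousAt.eventually_mem
        ((hΩ j).mem_nhds (by rw [h0, neg_zero]; exact hΩmem j))
    · exact (show Continuous fun x : P.State => x.2.2 j by fun_prop).continuousAt.eventually_mem
        ((hY j).mem_nhds (hYmem j))
    · exact (show Continuous fun x : P.State => x.2.2 j by fun_prop).continuousAt.eventually
        (eventually_nhdsWithin_iff.1 (hV j).2)
  have hmaps : ∀ j, Set.MapsTo (fun x : P.State => x.2.2 j) (Metric.closedBall xStar r) (Y j) :=
    fun j x hx => (hball hx).2.2.2.1 j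
  have hproj : ∀ j, Continuous fun x : P.State => x.2.2 j := fun j => by fun_prop
  have hUc : ContinuousOn (P.energy xStar V) (Metric.closedBall xStar r) :=
    P.continuousOn_energy xStar fun j =>
      (hVc j).continuousOn.comp (hproj j).continuousOn (hmaps j)
  have hdiss : ∀ x ∈ Metric.closedBall xStar r, ∀ j,
      P.dissipation xStar V x j ≤ -φ j (-x.2.1 j) := fun x hx j => by
    have := hVdiss j _ ((hball hx).2.2.1 j) _ (hmaps j hx)
    unfold PowerNetwork.dissipation
    linarith
  have hφ0 : ∀ j w, 0 ≤ φ j w := fun j w => by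
    by_cases h : w = 0
    · rw [h, (hφ j).1]
    · exact ((hφ j).2 w h).le
  have hdiss0 : ∀ x ∈ Metric.closedBall xStar r, ∀ j, P.dissipation xStar V x j ≤ 0 :=
    fun x hx j => (hdiss x hx j).trans (neg_nonpos.2 (hφ0 j _))
  have hW : ∀ x ∈ Metric.closedBall xStar r, ∑ j, P.dissipation xStar V x j ≤ 0 :=
    fun x hx => Finset.sum_nonpos fun j _ => hdiss0 x hx j
  have hWc : ContinuousOn (fun x => ∑ j, P.dissipation xStar V x j)
      (Metric.closedBall xStar r) :=
    continuousOn_finsetSum _ fun j _ => P.continuousOn_dissipation xStar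
      (((hVc j).continuousOn_fderiv_of_isOpen (hY j) le_rfl).comp (hproj j).continuousOn (hmaps j))
  have hderiv : ∀ (γ : ℝ → P.State) (t : ℝ), γ t ∈ Metric.closedBall xStar r →
      HasDerivAt γ (P.nominalField (γ t)) t → HasDerivAt (fun s => P.energy xStar V (γ s))
        (∑ j, P.dissipation xStar V (γ t) j) t := fun γ t ht h =>
    P.hasDerivAt_energy hω hsurplus (fun j => ((hVc j).contDiffAt
      ((hY j).mem_nhds (hmaps j ht))).differentiableAt one_ne_zero) h
  obtain ⟨Ξ, hΞ, hmem, hstab⟩ := exists_isOpen_forall_mem_closedBall hr hUc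
    (fun x hx hne => P.energy_lt_energy hω hangle (hball hx).1 (hball hx).2.2.2.2 hne) hderiv hW
  refine ⟨Ξ, hΞ, hmem, fun x hx hx0 => ?_⟩
  have hxd : ∀ T > 0, (∀ t ∈ Set.Icc 0 T, x t ∈ Metric.closedBall xStar r) →
      ∀ t ∈ Set.Ioo 0 T, HasDerivAt x (P.nominalField (x t)) t := fun T hT h =>
    hx.hasDerivAt P hT fun t ht => (hball (h t ht)).2.1
  have hxK := hstab x (hx.continuousOn P) hxd hx0
  have hxd' : ∀ t > 0, HasDerivAt x (P.nominalField (x t)) t := fun t ht =>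
    hxd (t + 1) (by linarith) (fun s hs => hxK s hs.1) t ⟨ht, by linarith⟩
  have hxK' : ∀ t > 0, x t ∈ Metric.closedBall xStar r := fun t ht => hxK t ht.le
  have hxev : ∀ᶠ t in atTop, x t ∈ Metric.closedBall xStar r := (eventually_gt_atTop 0).mono hxK'
  have hK := isCompact_closedBall xStar r
  have hW0 := tendsto_lyapunov_deriv_zero hK P.continuous_nominalField.continuousOn hUc hWc hW
    hxK' hxd' fun t ht => hderiv x t (hxK' t ht) (hxd' t ht)
  have hfreq : Tendsto (fun t => (x t).2.1) atTop (𝓝 0) := by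
    -- Since φ j need not be continuous, φ j (-ω j) → 0 would not give ω j → 0 directly. The
    -- dissipation is continuous, so it vanishes at each cluster point, and positivity of φ j is
    -- used there.
    refine tendsto_pi_nhds.2 fun j => (nhds_basis_opens 0).tendsto_right_iff.2 fun O hO => ?_
    refine hK.eventually_mem_of_forall_mapClusterPt hxev
      (hO.2.preimage (show Continuous fun q : P.State => q.2.1 j by fun_prop)) fun p hpK hp => ?_
    have hsum := hp.eq_of_tendsto hpK hxev hWc hW0
    have hz := (Finset.sum_eq_zero_iff_of_nonpos fun j _ => hdiss0 p hpK j).1 hsum j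
      (Finset.mem_univ j)
    have hpj : p.2.1 j = 0 := by
      by_contra hne
      linarith [hdiss p hpK j, (hφ j).2 _ (neg_ne_zero.2 hne)]
    rw [Set.mem_preimage, hpj]
    exact hO.1
  refine ⟨?_, hfreq⟩
  rw [Metric.tendsto_nhds]
  intro ε hε
  refine (hK.eventually_mem_of_forall_mapClusterPt hxev
    ((isOpen_Iio (a := ε)).preimage (Metric.continuous_infDist_pt P.equilibria))
    fun p hpK hp => ?_).mono fun t ht => ?_
  · have hpe := P.mem_equilibria_of_mapClusterPt hreg hK hxK' hxd' hfreq hpK hp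
    rw [Set.mem_preimage, Metric.infDist_zero_of_mem hpe]
    exact hε
  · rw [Real.dist_eq, sub_zero, abs_of_nonneg Metric.infDist_nonneg]
    exact ht
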